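/- Let $2\le n\le\infty$, let $\mathcal O_n$ be the Cuntz algebra, i.e. the unital C$^*$-algebra universally generated by $s_1,\dots,s_n$ (a sequence $s_1,s_2,\dots$ if $n=\infty$) with $s_i^*s_j=\delta_{ij}I$ and $\sum_{i=1}^n s_is_i^*=I$ if $n<\infty$, $\sum_{i=1}^k s_is_i^*\le I$ for all $k$ if $n=\infty$. Let $U(n)$ be the group of unitary operators on $\ell^2(\{1,\dots,n\})$ (on $\ell^2(\mathbb N)$ if $n=\infty$), and for $g=(g_{ij})\in U(n)$ let $\alpha_g$ be the unital $*$-endomorphism of $\mathcal O_n$ with $\alpha_g(s_i)=\sum_j g_{ji}s_j$. Representations are unital $*$-representations on Hilbert spaces. For a state $\omega$ on $\mathcal O_n$ with GNS triple $(\mathcal H_\omega,\pi_\omega,\Omega)$ put $$\mathcal K(\omega)=\overline{\mathrm{span}}\{\pi_\omega(s_{j_1}\cdots s_{j_l})^*\Omega : l\ge 0,\ j_1,\dots,j_l\},\qquad \mathrm{cdim}\,\omega=\dim\mathcal K(\omega)\in\{1,2,\dots,\infty\}$$ (all infinite dimensions are written $\infty$), and $\kappa(\omega)=\min\{\mathrm{cdim}\,\omega'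 : \omega'\sim\omega\}$, where $\omega'\sim\omega$ means that the GNS representations of $\omega'$ and $\omega$ are unitarily equivalent. (0) Let $\pi$ be an irreducible representation of $\mathcal O_n$ on $\mathcal H$. Then $\kappa(\langle x|\pi(\cdot)x\rangle)$ is the same for all unit vectors $x\in\mathcal H$. Denote this value by $\kappa(\pi)\in\{1,2,\dots,\infty\}$. (i) If $\pi,\pi'$ are unitarily equivalent irreducible representations of $\mathcal O_n$, then $\kappa(\pi)=\kappa(\pi')$. (ii) If $\pi$ is an irreducible representation of $\mathcal O_n$ and $g\in U(n)$, then $\pi\circ\alpha_g$ is irreducible and $\kappa(\pi\circ\alpha_g)=\kappa(\pi)$. (iii) Let $\mathcal H=\ell^2(\mathbb N)$, and let $\mathrm{Erg}_n\mathcal B(\mathcal H)$ be the set of unital $*$-endomorphisms $\varphi$ of $\mathcal B(\mathcal H)$ which have Powers index $n$, i.e. are of the form $\varphi=\varphi_\pi:=\sum_{i=1}^n\pi(s_i)(\cdot)\pi(s_i)^*$ (strongly convergent) for some representation $\pi$ of $\mathcal O_n$ on $\mathcal H$, and are ergodic, i.e. $\{X:\varphi(X)=X\}=\mathbb CI$.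 If $\varphi\in\mathrm{Erg}_n\mathcal B(\mathcal H)$, then every representation $\pi$ of $\mathcal O_n$ on $\mathcal H$ with $\varphi=\varphi_\pi$ is irreducible, and $\kappa(\varphi):=\kappa(\pi)\in\{1,2,\dots,\infty\}$ does not depend on the choice of such $\pi$. If moreover $\varphi'=\gamma\circ\varphi\circ\gamma^{-1}$ for a $*$-automorphism $\gamma$ of $\mathcal B(\mathcal H)$, then $\varphi'\in\mathrm{Erg}_n\mathcal B(\mathcal H)$ and $\kappa(\varphi')=\kappa(\varphi)$. -/

import Mathlib

open scoped ComplexOrder ENNReal InnerProductSpace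

universe u v

namespace Cuntz

noncomputable section

/-! ### Cuntz relations -/

/-- The index set of the Cuntz generators: `{0, …, n - 1}` for finite `n`, all of `ℕ` for `n = ∞`. -/
abbrev Idx (n : ℕ∞) : Type := {i : ℕ // (i : ℕ∞) < n}

/-- The Hilbert space `ℓ²(ι)`. -/
abbrev Ell2 (ι : Type) : Type := lp (fun _ : ι => ℂ) 2

/-- The Cuntz relations. The last condition is the one used for `n = ∞`; for finite `n` it
follows from the second one. -/
structure IsCuntzFamily {n : ℕ∞} {A : Type*} [CStarAlgebra A] [PartialOrder A]
    (s : Idx n → A) : Prop where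
  star_mul : ∀ i j, star (s i) * s j = if i = j then 1 else 0
  sum_eq_one : ∀ [Fintype (Idx n)], ∑ i, s i * star (s i) = 1
  sum_le_one : ∀ F : Finset (Idx n), ∑ i ∈ F, s i * star (s i) ≤ 1

section Relations

variable {ι A : Type*} [CStarAlgebra A] {s : ι → A}

theorem sum_mul_star_le_one [PartialOrder A] [StarOrderedRing A] [DecidableEq ι]
    (h : ∀ i j, star (s i) * s j = if i = j then 1 else 0) (F : Finset ι) :
    ∑ i ∈ F, s i * star (s i) ≤ 1 := by
  refine IsStarProjection.le_one ⟨?_, ?_⟩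
  · change (∑ i ∈ F, s i * star (s i)) * (∑ i ∈ F, s i * star (s i)) = _
    rw [Finset.sum_mul]
    refine Finset.sum_congr rfl fun i hi => ?_
    rw [Finset.mul_sum, Finset.sum_eq_single i]
    · rw [mul_assoc, ← mul_assoc (star (s i)), h, if_pos rfl, one_mul]
    · intro j _ hj
      rw [mul_assoc, ← mul_assoc (star (s i)), h, if_neg (Ne.symm hj), zero_mul, mul_zero]
    · intro hi'
      exact absurd hi hi'
  · simp [IsSelfAdjoint, star_sum]

theorem norm_le_one_of_star_mul {a : A} (h : star a * a = 1) : ‖a‖ ≤ 1 := by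
  rcases subsingleton_or_nontrivial A with hA | hA
  · rw [Subsingleton.elim a 0, norm_zero]
    exact zero_le_one
  · have h1 := CStarRing.norm_star_mul_self (x := a)
    rw [h, CStarRing.norm_one] at h1
    nlinarith [norm_nonneg a]

theorem star_sum_mul_sum [DecidableEq ι]
    (h : ∀ i j, star (s i) * s j = if i = j then 1 else 0) (c d : ι → ℂ) (F : Finset ι) :
    star (∑ i ∈ F, c i • s i) * ∑ j ∈ F, d j • s j = (∑ i ∈ F, star (c i) * d i) • (1 : A) := by
  rw [star_sum, Finset.sum_mul, Finset.sum_smul]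
  refine Finset.sum_congr rfl fun i hi => ?_
  rw [Finset.mul_sum, Finset.sum_eq_single i]
  · rw [star_smul, smul_mul_smul_comm, h, if_pos rfl]
  · intro j _ hj
    rw [star_smul, smul_mul_smul_comm, h, if_neg (Ne.symm hj), smul_zero]
  · intro hi'
    exact absurd hi hi'

/-- For orthogonal isometries `s i` and `c ∈ ℓ²`, the series `∑ i, c i • s i` converges in norm. -/
theorem summable_smul [DecidableEq ι]
    (h : ∀ i j, star (s i) * s j = if i = j then 1 else 0) (c : lp (fun _ : ι => ℂ) 2) :
    Summable fun i => c i • s i := by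
  rw [summable_iff_vanishing_norm]
  intro ε hε
  have hc : Summable fun i => ‖c i‖ ^ 2 := by
    simpa using (lp.memℓp c).summable (by norm_num)
  obtain ⟨F, hF⟩ := summable_iff_vanishing_norm.1 hc (ε ^ 2) (by positivity)
  refine ⟨F, fun G hG => ?_⟩
  have h1 := hF G hG
  have h2 := CStarRing.norm_star_mul_self (x := ∑ i ∈ G, c i • s i)
  rw [star_sum_mul_sum h] at h2
  have h3 : (∑ i ∈ G, star (c i) * c i : ℂ) = ((∑ i ∈ G, ‖c i‖ ^ 2 : ℝ) : ℂ) := by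
    push_cast
    exact Finset.sum_congr rfl fun i _ => by simpa using Complex.conj_mul' (c i)
  rw [h3, norm_smul, Complex.norm_real] at h2
  have h4 : ‖(1 : A)‖ ≤ 1 := norm_le_one_of_star_mul (by simp)
  have h5 : ‖∑ i ∈ G, c i • s i‖ * ‖∑ i ∈ G, c i • s i‖ < ε ^ 2 := by
    rw [← h2]
    calc _ ≤ ‖∑ i ∈ G, ‖c i‖ ^ 2‖ * 1 := by gcongr
      _ < ε ^ 2 := by simpa using h1
  exact lt_of_pow_lt_pow_left₀ 2 hε.le (by rwa [pow_two])

theorem star_tsum_mul_tsum [DecidableEq ι]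
    (h : ∀ i j, star (s i) * s j = if i = j then 1 else 0) (c d : lp (fun _ : ι => ℂ) 2) :
    star (∑' i, c i • s i) * ∑' i, d i • s i = ⟪c, d⟫_ℂ • (1 : A) := by
  have hc : Filter.Tendsto (fun F => ∑ i ∈ F, c i • s i) Filter.atTop (nhds (∑' i, c i • s i)) := by
    simpa [HasSum] using (summable_smul h c).hasSum
  have hd : Filter.Tendsto (fun F => ∑ i ∈ F, d i • s i) Filter.atTop (nhds (∑' i, d i • s i)) := by
    simpa [HasSum] using (summable_smul h d).hasSum
  have hi : Filter.Tendsto (fun F => ∑ i ∈ F, ⟪c i, d i⟫_ℂ) Filter.atTop (nhds ⟪c, d⟫_ℂ) := by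
    simpa [HasSum, -RCLike.inner_apply] using lp.hasSum_inner c d
  refine tendsto_nhds_unique (hc.star.mul hd) ((hi.smul_const (1 : A)).congr fun F => ?_)
  rw [star_sum_mul_sum h]
  congr 1
  refine Finset.sum_congr rfl fun i _ => ?_
  simp [mul_comm]

end Relations

/-! ### The unitary group `U(n)` and its action on Cuntz families -/

/-- The group `U(n)` of all unitary operators on `ℓ²(Idx n)`. -/
abbrev U (n : ℕ∞) : Type := unitary (Ell2 (Idx n) →L[ℂ] Ell2 (Idx n))

/-- The matrix entry `g_{ij}` of `g ∈ U(n)`, i.e. the `i`-th coordinate of `g e_j`. -/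
def entry {n : ℕ∞} (g : U n) (i j : Idx n) : ℂ :=
  ((g : Ell2 (Idx n) →L[ℂ] Ell2 (Idx n)) (lp.single 2 j (1 : ℂ))) i

theorem entry_orthonormal {n : ℕ∞} (g : U n) (i j : Idx n) :
    ⟪(g : Ell2 (Idx n) →L[ℂ] Ell2 (Idx n)) (lp.single 2 i (1 : ℂ)),
      (g : Ell2 (Idx n) →L[ℂ] Ell2 (Idx n)) (lp.single 2 j (1 : ℂ))⟫_ℂ =
      if i = j then 1 else 0 := by
  rw [← ContinuousLinearMap.adjoint_inner_right, ← mul_apply_eq_comp,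
    ← ContinuousLinearMap.star_eq_adjoint, Unitary.coe_star_mul_self g,
    one_apply_eq_self, lp.inner_single_left, lp.single_apply]
  by_cases hij : i = j
  · subst hij
    simp
  · simp [hij]

theorem entry_eq {n : ℕ∞} (g : U n) (i j : Idx n) :
    entry g i j = star (entry (star g) j i) := by
  have h1 : entry g i j = ⟪lp.single 2 i (1 : ℂ),
      (g : Ell2 (Idx n) →L[ℂ] Ell2 (Idx n)) (lp.single 2 j (1 : ℂ))⟫_ℂ := by
    rw [lp.inner_single_left]
    simp [entry]
  have h2 : entry (star g) j i = ⟪lp.single 2 j (1 : ℂ),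
      ((star g : U n) : Ell2 (Idx n) →L[ℂ] Ell2 (Idx n)) (lp.single 2 i (1 : ℂ))⟫_ℂ := by
    rw [lp.inner_single_left]
    simp [entry]
  rw [h1, h2, Unitary.coe_star, ContinuousLinearMap.star_eq_adjoint,
    ContinuousLinearMap.adjoint_inner_right]
  exact (inner_conj_symm _ _).symm

theorem sum_entry_mul_star {n : ℕ∞} [Fintype (Idx n)] (g : U n) (j k : Idx n) :
    ∑ i, entry g j i * star (entry g k i) = if j = k then 1 else 0 := by
  rw [← entry_orthonormal (star g) j k, lp.inner_eq_tsum, tsum_fintype]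
  refine Finset.sum_congr rfl fun i _ => ?_
  rw [entry_eq g j i, entry_eq g k i, star_star]
  simp [entry, mul_comm]

/-- The family `i ↦ ∑ j, g_{ji} s_j`. -/
def rotate {n : ℕ∞} {A : Type*} [CStarAlgebra A] (g : U n) (s : Idx n → A) (i : Idx n) : A :=
  ∑' j, entry g j i • s j

theorem hasSum_rotate {n : ℕ∞} {A : Type*} [CStarAlgebra A] (g : U n) {s : Idx n → A}
    (h : ∀ i j, star (s i) * s j = if i = j then 1 else 0) (i : Idx n) :
    HasSum (fun j => entry g j i • s j) (rotate g s i) :=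
  (summable_smul h ((g : Ell2 (Idx n) →L[ℂ] Ell2 (Idx n)) (lp.single 2 i (1 : ℂ)))).hasSum

theorem IsCuntzFamily.rotate {n : ℕ∞} {A : Type*} [CStarAlgebra A] [PartialOrder A]
    [StarOrderedRing A] {s : Idx n → A} (h : IsCuntzFamily s) (g : U n) :
    IsCuntzFamily (Cuntz.rotate g s) := by
  have hm : ∀ i j, star (Cuntz.rotate g s i) * Cuntz.rotate g s j = if i = j then 1 else 0 := by
    intro i j
    refine (star_tsum_mul_tsum h.star_mul
      ((g : Ell2 (Idx n) →L[ℂ] Ell2 (Idx n)) (lp.single 2 i (1 : ℂ)))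
      ((g : Ell2 (Idx n) →L[ℂ] Ell2 (Idx n)) (lp.single 2 j (1 : ℂ)))).trans ?_
    rw [entry_orthonormal]
    split_ifs <;> simp
  refine ⟨hm, ?_, sum_mul_star_le_one hm⟩
  intro _
  have h1 : ∀ i, Cuntz.rotate g s i * star (Cuntz.rotate g s i) =
      ∑ j, ∑ k, (entry g j i * star (entry g k i)) • (s j * star (s k)) := by
    intro i
    rw [Cuntz.rotate, tsum_fintype, star_sum, Finset.sum_mul]
    refine Finset.sum_congr rfl fun j _ => ?_
    rw [Finset.mul_sum]
    refine Finset.sum_congr rfl fun k _ => ?_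
    rw [star_smul, smul_mul_smul_comm]
  rw [Finset.sum_congr rfl fun i _ => h1 i, Finset.sum_comm, ← h.sum_eq_one]
  refine Finset.sum_congr rfl fun j _ => ?_
  rw [Finset.sum_comm]
  simp_rw [← Finset.sum_smul, sum_entry_mul_star]
  simp

/-! ### The Cuntz algebra -/

/-- Cuntz families of operators on the separable infinite-dimensional Hilbert space. -/
abbrev CuntzFamily (n : ℕ∞) : Type :=
  {S : Idx n → (Ell2 ℕ →L[ℂ] Ell2 ℕ) // IsCuntzFamily S}

/-- The C⋆-algebra of bounded families of operators indexed by all Cuntz families. -/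
abbrev Ambient (n : ℕ∞) : Type := lp (fun _ : CuntzFamily n => Ell2 ℕ →L[ℂ] Ell2 ℕ) ∞

instance : Nontrivial (Ell2 ℕ) :=
  ⟨lp.single 2 0 (1 : ℂ), 0, fun h => by
    simpa using congrArg (fun f : Ell2 ℕ => f 0) h⟩

instance (n : ℕ∞) : CStarAlgebra (Ambient n) where

/-- The universal tuple: its coordinate at a Cuntz family `S` is `S i`. -/
def ambientGen (n : ℕ∞) (i : Idx n) : Ambient n :=
  ⟨fun S => S.1 i, memℓp_infty ⟨1, by
    rintro _ ⟨S, rfl⟩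
    exact norm_le_one_of_star_mul (by simpa using S.2.star_mul i i)⟩⟩

theorem ambientGen_star_mul (n : ℕ∞) (i j : Idx n) :
    star (ambientGen n i) * ambientGen n j = if i = j then 1 else 0 := by
  ext1
  funext S
  refine (S.2.star_mul i j).trans ?_
  split_ifs <;> rfl

/-- The C⋆-subalgebra generated by the universal tuple. -/
def cuntzSubalgebra (n : ℕ∞) : StarSubalgebra ℂ (Ambient n) :=
  (StarAlgebra.adjoin ℂ (Set.range (ambientGen n))).topologicalClosure

/-- The Cuntz algebra `𝒪ₙ`: the C⋆-algebra generated by the universal tuple, i.e. the completion of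
the `⋆`-algebra generated by symbols `sᵢ` in the norm `‖p‖ = sup ‖p(S)‖`, where `S` runs over all
Cuntz families on `ℓ²(ℕ)`. For `n ≥ 2` this is the universal C⋆-algebra of the Cuntz relations:
every Cuntz family on a Hilbert space is a direct sum of families on cyclic reducing subspaces,
and a nonzero cyclic one is separable and infinite-dimensional, hence is unitarily equivalent to a
family on `ℓ²(ℕ)`; so the supremum is also the one over all Cuntz families on all Hilbert
spaces. -/
def CuntzAlgebra (n : ℕ∞) : Type := cuntzSubalgebra n

def cuntzCStarAlgebra (n : ℕ∞) : CStarAlgebra (CuntzAlgebra n) :=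
  StarSubalgebra.cstarAlgebra (cuntzSubalgebra n)
    (h_closed := StarSubalgebra.isClosed_topologicalClosure _)

instance (n : ℕ∞) : CStarAlgebra (CuntzAlgebra n) := cuntzCStarAlgebra n

/-- `a ≤ b` iff `b - a` is a positive element of the C⋆-algebra. -/
instance (n : ℕ∞) : PartialOrder (CuntzAlgebra n) := CStarAlgebra.spectralOrder _

instance (n : ℕ∞) : StarOrderedRing (CuntzAlgebra n) := CStarAlgebra.spectralOrderedRing _

/-- The Cuntz generators `sᵢ`. -/
def gen (n : ℕ∞) (i : Idx n) : CuntzAlgebra n :=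
  ⟨ambientGen n i, StarSubalgebra.le_topologicalClosure _
    (StarAlgebra.subset_adjoin ℂ _ ⟨i, rfl⟩)⟩

theorem gen_isCuntzFamily (n : ℕ∞) : IsCuntzFamily (gen n) := by
  have hm : ∀ i j, star (gen n i) * gen n j = if i = j then 1 else 0 := by
    intro i j
    apply Subtype.ext
    refine (ambientGen_star_mul n i j).trans ?_
    split_ifs <;> rfl
  refine ⟨hm, ?_, sum_mul_star_le_one hm⟩
  intro _
  have h1 : ∑ i, ambientGen n i * star (ambientGen n i) = 1 := by
    ext1
    funext S
    have := S.2.sum_eq_one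
    rw [lp.coeFn_sum, Finset.sum_apply]
    exact this
  apply Subtype.ext
  refine Eq.trans ?_ h1
  exact map_sum (cuntzSubalgebra n).subtype (fun i => gen n i * star (gen n i)) Finset.univ

/-! ### The action of `U(n)` on the Cuntz algebra -/

/-- Reindexing of a bounded family along the action of `g` on Cuntz families. -/
def rotateAmbient {n : ℕ∞} (g : U n) : Ambient n →⋆ₐ[ℂ] Ambient n where
  toFun x := ⟨fun S => x ⟨rotate g S.1, S.2.rotate g⟩, memℓp_infty ⟨‖x‖, by
    rintro _ ⟨S, rfl⟩
    exact lp.norm_apply_le_norm ENNReal.top_ne_zero x _⟩⟩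
  map_one' := rfl
  map_mul' _ _ := rfl
  map_zero' := rfl
  map_add' _ _ := rfl
  commutes' _ := rfl
  map_star' _ := rfl

theorem rotateAmbient_gen {n : ℕ∞} (g : U n) (i : Idx n) :
    rotateAmbient g (ambientGen n i) = rotate g (ambientGen n) i := by
  ext1
  funext S
  have h1 := hasSum_rotate g (ambientGen_star_mul n) i
  have h2 := h1.map (lp.evalCLM ℂ (fun _ : CuntzFamily n => Ell2 ℕ →L[ℂ] Ell2 ℕ) ∞ S) (by fun_prop)
  exact (hasSum_rotate g S.2.star_mul i).unique h2

theorem rotateAmbient_mem {n : ℕ∞} (g : U n) (a : CuntzAlgebra n) :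
    rotateAmbient g a.1 ∈ cuntzSubalgebra n := by
  have hcl : IsClosed (cuntzSubalgebra n : Set (Ambient n)) :=
    StarSubalgebra.isClosed_topologicalClosure _
  have h : cuntzSubalgebra n ≤ (cuntzSubalgebra n).comap (rotateAmbient g) := by
    refine StarSubalgebra.topologicalClosure_minimal ?_ ?_
    · refine StarAlgebra.adjoin_le ?_
      rintro _ ⟨i, rfl⟩
      change rotateAmbient g (ambientGen n i) ∈ cuntzSubalgebra n
      rw [rotateAmbient_gen]
      refine hcl.mem_of_tendsto (hasSum_rotate g (ambientGen_star_mul n) i)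
        (Filter.Eventually.of_forall fun F => ?_)
      exact sum_mem fun j _ => SMulMemClass.smul_mem _ (gen n j).2
    · exact hcl.preimage (AddMonoidHomClass.continuous_of_bound (rotateAmbient g) 1
        fun x => by rw [one_mul]; exact NonUnitalStarAlgHom.norm_apply_le _ x)
  exact h a.2

/-- The action `α` of `U(n)` on the Cuntz algebra: the unital `⋆`-homomorphism with
`α_g(s_i) = ∑ j, g_{ji} s_j`, see `hasSum_action_gen`. -/
def action {n : ℕ∞} (g : U n) : CuntzAlgebra n →⋆ₐ[ℂ] CuntzAlgebra n :=
  ((rotateAmbient g).comp (cuntzSubalgebra n).subtype).codRestrict (cuntzSubalgebra n)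
    (rotateAmbient_mem g)

theorem hasSum_action_gen {n : ℕ∞} (g : U n) (i : Idx n) :
    HasSum (fun j => entry g j i • gen n j) (action g (gen n i)) := by
  have h1 : action g (gen n i) = rotate g (gen n) i := by
    apply Subtype.ext
    have h2 := (hasSum_rotate g (gen_isCuntzFamily n).star_mul i).map
      (cuntzSubalgebra n).subtype continuous_subtype_val
    exact (rotateAmbient_gen g i).trans
      ((hasSum_rotate g (ambientGen_star_mul n) i).unique h2)
  rw [h1]
  exact hasSum_rotate g (gen_isCuntzFamily n).star_mul i

/-! ### Representations -/

/-- Unital `⋆`-representations of the Cuntz algebra on a Hilbert space `H`. -/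
abbrev Rep (n : ℕ∞) (H : Type*) [NormedAddCommGroup H] [InnerProductSpace ℂ H]
    [CompleteSpace H] : Type _ :=
  CuntzAlgebra n →⋆ₐ[ℂ] (H →L[ℂ] H)

section Representations

variable {n : ℕ∞} {H : Type*} [NormedAddCommGroup H] [InnerProductSpace ℂ H] [CompleteSpace H]
  {H' : Type*} [NormedAddCommGroup H'] [InnerProductSpace ℂ H'] [CompleteSpace H']

/-- `H ≠ 0` and the only closed invariant subspaces are `0` and `H`. -/
def IsIrreducible (π : Rep n H) : Prop :=
  Nontrivial H ∧ ∀ M : Submodule ℂ H, IsClosed (M : Set H) →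
    (∀ a, ∀ v ∈ M, π a v ∈ M) → M = ⊥ ∨ M = ⊤

/-- A unitary `W : H → H'` intertwines `π` and `π'`. -/
def UnitarilyEquivalent (π : Rep n H) (π' : Rep n H') : Prop :=
  ∃ W : H ≃ₗᵢ[ℂ] H', ∀ a v, W (π a v) = π' a (W v)

end Representations

/-! ### States, their GNS representations, and the invariant `κ` -/

/-- States: positive linear functionals with `ω(1) = 1`. -/
abbrev State (n : ℕ∞) : Type := {ω : CuntzAlgebra n →ₚ[ℂ] ℂ // ω 1 = 1}

/-- The GNS representation of a state. -/
def gnsRep {n : ℕ∞} (ω : State n) : Rep n ω.1.GNS := ω.1.gnsStarAlgHom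

/-- The GNS cyclic vector `Ω`, the class of the unit. -/
def gnsVector {n : ℕ∞} (ω : State n) : ω.1.GNS :=
  ((ω.1.toPreGNS 1 : ω.1.PreGNS) : UniformSpace.Completion ω.1.PreGNS)

/-- `s_J = s_{j₁} ⋯ s_{jₗ}`, with `s_∅ = 1`. -/
def word {n : ℕ∞} (J : List (Idx n)) : CuntzAlgebra n := (J.map (gen n)).prod

/-- `𝒦(ω)`, the closed linear span of the vectors `π(s_J)^* Ω`. -/
def correlationSpace {n : ℕ∞} (ω : State n) : Submodule ℂ ω.1.GNS :=
  (Submodule.span ℂ (Set.range fun J : List (Idx n) =>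
    star (gnsRep ω (word J)) (gnsVector ω))).topologicalClosure

/-- `cdim ω = dim 𝒦(ω) ∈ {1, 2, …, ∞}`, where every infinite dimension counts as `∞`. -/
def cdim {n : ℕ∞} (ω : State n) : ℕ∞ := Cardinal.toENat (Module.rank ℂ (correlationSpace ω))

/-- `ω ∼ ω'`: the GNS representations are unitarily equivalent. -/
def StateEquiv {n : ℕ∞} (ω ω' : State n) : Prop := UnitarilyEquivalent (gnsRep ω) (gnsRep ω')

/-- `κ(ω) = min {cdim ω' : ω' ∼ ω}`. -/
def kappa {n : ℕ∞} (ω : State n) : ℕ∞ := sInf {d | ∃ ω' : State n, StateEquiv ω' ω ∧ cdim ω' = d}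

/-- The infimum defining `κ(ω)` is attained. -/
theorem kappa_isLeast {n : ℕ∞} (ω : State n) :
    IsLeast {d | ∃ ω' : State n, StateEquiv ω' ω ∧ cdim ω' = d} (kappa ω) :=
  ⟨csInf_mem ⟨cdim ω, ω, ⟨LinearIsometryEquiv.refl ℂ _, fun _ _ => rfl⟩, rfl⟩,
    fun _ hd => sInf_le hd⟩

section Kappa

variable {n : ℕ∞} {H : Type*} [NormedAddCommGroup H] [InnerProductSpace ℂ H] [CompleteSpace H]

/-- The vector state `ω_x ∘ π = ⟨x, π(·) x⟩` of a unit vector `x`. -/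
def vectorState (π : Rep n H) (x : H) (hx : ‖x‖ = 1) : State n :=
  ⟨PositiveLinearMap.mk₀
    { toFun := fun a => ⟪x, π a x⟫_ℂ
      map_add' := fun a b => by simp
      map_smul' := fun c a => by simp }
    (fun a ha => by
      obtain ⟨b, rfl⟩ := CStarAlgebra.nonneg_iff_eq_star_mul_self.1 ha
      change 0 ≤ ⟪x, π (star b * b) x⟫_ℂ
      rw [map_mul, map_star, mul_apply_eq_comp, ContinuousLinearMap.star_eq_adjoint,
        ContinuousLinearMap.adjoint_inner_right]
      rw [inner_self_eq_norm_sq_to_K]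
      positivity),
    by
      change ⟪x, π 1 x⟫_ℂ = 1
      rw [map_one, one_apply_eq_self, inner_self_eq_norm_sq_to_K, hx]
      simp⟩

open Classical in
/-- `κ(π) = κ(ω_x ∘ π)` for a chosen unit vector `x` (and the junk value `0` if `H = 0`). -/
def kappaRep (π : Rep n H) : ℕ∞ :=
  if h : ∃ x : H, ‖x‖ = 1 then kappa (vectorState π h.choose h.choose_spec) else 0

end Kappa

/-! ### Endomorphisms of `B(ℋ)` for `ℋ = ℓ²(ℕ)` -/

/-- Unital `⋆`-endomorphisms of `B(ℋ)`. -/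
abbrev EndB : Type := (Ell2 ℕ →L[ℂ] Ell2 ℕ) →⋆ₐ[ℂ] (Ell2 ℕ →L[ℂ] Ell2 ℕ)

/-- `φ = φ_π = ∑ i, π(s_i) (·) π(s_i)^*`, with convergence in the strong operator topology. -/
def IsImplementedBy {n : ℕ∞} (φ : EndB) (π : Rep n (Ell2 ℕ)) : Prop :=
  ∀ (X : Ell2 ℕ →L[ℂ] Ell2 ℕ) (v : Ell2 ℕ),
    HasSum (fun i => (π (gen n i) * X * star (π (gen n i))) v) (φ X v)

/-- `φ` has Powers index `n`. -/
def HasPowersIndex (φ : EndB) (n : ℕ∞) : Prop := ∃ π : Rep n (Ell2 ℕ), IsImplementedBy φ π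

/-- The fixed points of `φ` are exactly the scalars. -/
def IsErgodic (φ : EndB) : Prop :=
  {X : Ell2 ℕ →L[ℂ] Ell2 ℕ | φ X = X} = Set.range fun c : ℂ => c • (1 : Ell2 ℕ →L[ℂ] Ell2 ℕ)

/-- The set of ergodic endomorphisms of Powers index `n`. -/
def Erg (n : ℕ∞) : Set EndB := {φ | HasPowersIndex φ n ∧ IsErgodic φ}

/-- Conjugacy: `φ₂ = γ ∘ φ₁ ∘ γ⁻¹` for an automorphism `γ` of `B(ℋ)`. -/
def Conjugate (φ₁ φ₂ : EndB) : Prop :=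
  ∃ γ : (Ell2 ℕ →L[ℂ] Ell2 ℕ) ≃⋆ₐ[ℂ] (Ell2 ℕ →L[ℂ] Ell2 ℕ), ∀ X, φ₂ X = γ (φ₁ (γ.symm X))

open Classical in
/-- `κ(φ) = κ(π)` for a chosen representation `π` with `φ = φ_π`
(and the junk value `0` if there is none). -/
def kappaEnd (n : ℕ∞) (φ : EndB) : ℕ∞ :=
  if h : HasPowersIndex φ n then kappaRep h.choose else 0

end

end Cuntz

namespace Cuntz

noncomputable section

/-! ### Uniqueness of homomorphisms on the Cuntz algebra -/

/-! Everything reduces to `minCorrDim π`, the least dimension, over unit vectors `y` of `H`, of the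
smallest closed subspace containing `y` and invariant under all `π(s_i)^*`. This number refers to no
state and no chosen vector.

For irreducible `π` every unit vector `x` is cyclic, so the GNS triple of its vector state is `(H,
π, x)`. A state equivalent to it has its cyclic vector transported to a unit vector of `H`, with the
same correlation dimension. Hence `κ = minCorrDim π` (`kappa_vectorState`), and unitary invariance
is immediate.

The other invariances rest on `corrSpace_le_of_mem_closure`: a closed `K` is invariant under
`π(s_i)^*` iff `Kᗮ` is invariant under `π(s_i)`, and the latter passes to linear combinations and
strong limits. So the correlation space depends only on the strongly closed span of the `π(s_i)`.
Rotation by `g ∈ U(n)` preserves that span. So does changing the representation that implements `φ`: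
each `π(s_i)^* π'(s_j)` commutes with `B(ℋ)`, hence is a scalar, and `φ(1) = 1` expands `π'(s_j)` in
the `π(s_i)`.

Ergodicity forces irreducibility because the projection onto an invariant subspace is fixed by `φ`.
Conjugacy reduces to unitary equivalence because automorphisms of `B(ℋ)` are spatial. -/

theorem eq_top_of_gen_mem {n : ℕ∞} (S : StarSubalgebra ℂ (CuntzAlgebra n))
    (hS : IsClosed (S : Set (CuntzAlgebra n))) (h : ∀ i, gen n i ∈ S) : S = ⊤ := by
  have hcl : IsClosed (cuntzSubalgebra n : Set (Ambient n)) :=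
    StarSubalgebra.isClosed_topologicalClosure _
  have hle : cuntzSubalgebra n ≤ S.map (cuntzSubalgebra n).subtype := by
    refine StarSubalgebra.topologicalClosure_minimal ?_ ?_
    · refine StarAlgebra.adjoin_le ?_
      rintro _ ⟨i, rfl⟩
      exact ⟨gen n i, h i, rfl⟩
    · exact hcl.isClosedEmbedding_subtypeVal.isClosedMap _ hS
  refine eq_top_iff.2 fun a _ => ?_
  obtain ⟨b, hb, hba⟩ := hle a.2
  have : b = a := Subtype.ext hba
  exact this ▸ hb

theorem continuous_starAlgHom {n : ℕ∞} {B : Type*} [CStarAlgebra B]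
    (f : CuntzAlgebra n →⋆ₐ[ℂ] B) : Continuous f :=
  AddMonoidHomClass.continuous_of_bound f 1
    fun x => by rw [one_mul]; exact NonUnitalStarAlgHom.norm_apply_le _ x

theorem starAlgHom_ext {n : ℕ∞} {B : Type*} [CStarAlgebra B] {f f' : CuntzAlgebra n →⋆ₐ[ℂ] B}
    (h : ∀ i, f (gen n i) = f' (gen n i)) : f = f' := by
  have htop := eq_top_of_gen_mem (StarAlgHom.equalizer f f') (isClosed_eq (continuous_starAlgHom f) (continuous_starAlgHom f')) h
  ext a
  have ha : a ∈ StarAlgHom.equalizer f f' := htop ▸ StarSubalgebra.mem_top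
  exact ha

/-! ### The action is by automorphisms -/

/-- The linear map `c ↦ ∑ i, c i • s i` from `ℓ²` to the span of orthogonal isometries. -/
def smulSum {ι A : Type*} [CStarAlgebra A] [DecidableEq ι] {s : ι → A}
    (h : ∀ i j, star (s i) * s j = if i = j then 1 else 0) :
    lp (fun _ : ι => ℂ) 2 →L[ℂ] A :=
  LinearMap.mkContinuous
    { toFun := fun c => ∑' i, c i • s i
      map_add' := fun c d => by
        rw [← (summable_smul h c).tsum_add (summable_smul h d)]
        exact tsum_congr fun i => by simp [add_smul]
      map_smul' := fun r c => by
        rw [RingHom.id_apply, ← (summable_smul h c).tsum_const_smul]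
        exact tsum_congr fun i => by simp [smul_smul] } 1
    fun c => by
      have h1 := CStarRing.norm_star_mul_self (x := ∑' i, c i • s i)
      rw [star_tsum_mul_tsum h, norm_smul, inner_self_eq_norm_sq_to_K] at h1
      -- Only an inequality, since `A` may be the zero algebra.
      have h2 : ‖(1 : A)‖ ≤ 1 := norm_le_one_of_star_mul (by simp)
      have h3 : ‖∑' i, c i • s i‖ ^ 2 ≤ ‖c‖ ^ 2 := by
        rw [pow_two, ← h1]
        simpa using mul_le_mul_of_nonneg_left h2 (sq_nonneg ‖c‖)
      rw [one_mul]
      exact le_of_sq_le_sq h3 (norm_nonneg c)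

theorem smulSum_apply {ι A : Type*} [CStarAlgebra A] [DecidableEq ι] {s : ι → A}
    (h : ∀ i j, star (s i) * s j = if i = j then 1 else 0) (c : lp (fun _ : ι => ℂ) 2) :
    smulSum h c = ∑' i, c i • s i := rfl

theorem smulSum_single {ι A : Type*} [CStarAlgebra A] [DecidableEq ι] {s : ι → A}
    (h : ∀ i j, star (s i) * s j = if i = j then 1 else 0) (i : ι) (r : ℂ) :
    smulSum h (lp.single 2 i r) = r • s i := by
  rw [smulSum_apply, tsum_eq_single i]
  · rw [lp.single_apply_self]
  · intro j hj
    rw [lp.single_apply_ne _ _ _ hj, zero_smul]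

theorem action_gen {n : ℕ∞} (g : U n) (i : Idx n) :
    action g (gen n i) = smulSum (gen_isCuntzFamily n).star_mul
      ((g : Ell2 (Idx n) →L[ℂ] Ell2 (Idx n)) (lp.single 2 i (1 : ℂ))) :=
  ((hasSum_action_gen g i).tsum_eq).symm

/-- The closed span of the generators is a copy of `ℓ²`, on which `α_g` acts as `g` itself; both
sides are continuous and agree on basis vectors. Composing actions thus becomes composing unitaries.
-/
theorem action_smulSum {n : ℕ∞} (g : U n) (c : Ell2 (Idx n)) :
    action g (smulSum (gen_isCuntzFamily n).star_mul c) =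
      smulSum (gen_isCuntzFamily n).star_mul
        ((g : Ell2 (Idx n) →L[ℂ] Ell2 (Idx n)) c) := by
  have hc := lp.hasSum_single (p := 2) (by simp) c
  have h1 := ((hc.map (smulSum (gen_isCuntzFamily n).star_mul)
    (ContinuousLinearMap.continuous _)).map (action g) (continuous_starAlgHom _))
  have h2 := ((hc.map (g : Ell2 (Idx n) →L[ℂ] Ell2 (Idx n))
    (ContinuousLinearMap.continuous _)).map (smulSum (gen_isCuntzFamily n).star_mul)
    (ContinuousLinearMap.continuous _))
  have hi : ∀ i, smulSum (gen_isCuntzFamily n).star_mul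
      ((g : Ell2 (Idx n) →L[ℂ] Ell2 (Idx n)) (lp.single 2 i (c i))) =
      action g (smulSum (gen_isCuntzFamily n).star_mul (lp.single 2 i (c i))) := fun i => by
    rw [← mul_one (c i), ← smul_eq_mul, lp.single_smul, map_smul, map_smul, map_smul, map_smul,
      smulSum_single, one_smul, action_gen]
  refine h1.unique ?_
  convert h2 using 1
  exact funext fun i => (hi i).symm

theorem action_comp_star {n : ℕ∞} (g : U n) :
    (action g).comp (action (star g)) = StarAlgHom.id ℂ (CuntzAlgebra n) := by
  refine starAlgHom_ext fun i => ?_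
  rw [StarAlgHom.comp_apply, action_gen, action_smulSum, ← mul_apply_eq_comp, Unitary.coe_star,
    Unitary.mul_star_self_of_mem g.2, one_apply_eq_self, smulSum_single, one_smul]
  rfl

theorem action_surjective {n : ℕ∞} (g : U n) : Function.Surjective (action g) := fun a =>
  ⟨action (star g) a, DFunLike.congr_fun (action_comp_star g) a⟩

/-! ### Correlation spaces of vectors in representations -/

section Correlation

variable {n : ℕ∞} {H : Type*} [NormedAddCommGroup H] [InnerProductSpace ℂ H] [CompleteSpace H]
  {H' : Type*} [NormedAddCommGroup H'] [InnerProductSpace ℂ H'] [CompleteSpace H']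

/-- The closed linear span of the vectors `π(s_J)^* x`. -/
def corrSpace (π : Rep n H) (x : H) : Submodule ℂ H :=
  (Submodule.span ℂ (Set.range fun J : List (Idx n) => star (π (word J)) x)).topologicalClosure

/-- The dimension of `corrSpace π x`, where every infinite dimension counts as `∞`. -/
def corrDim (π : Rep n H) (x : H) : ℕ∞ := Cardinal.toENat (Module.rank ℂ (corrSpace π x))

theorem isClosed_corrSpace (π : Rep n H) (x : H) : IsClosed (corrSpace π x : Set H) :=
  Submodule.isClosed_topologicalClosure _

theorem star_word_mem_corrSpace (π : Rep n H) (x : H) (J : List (Idx n)) :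
    star (π (word J)) x ∈ corrSpace π x :=
  Submodule.le_topologicalClosure _ (Submodule.subset_span ⟨J, rfl⟩)

theorem mem_corrSpace_self (π : Rep n H) (x : H) : x ∈ corrSpace π x := by
  simpa [word] using star_word_mem_corrSpace π x []

/-- Minimality of the correlation space among closed subspaces containing `x` and invariant under
the `π(s_i)^*`. It replaces words by single generators below. -/
theorem corrSpace_le {π : Rep n H} {x : H} {K : Submodule ℂ H} (hK : IsClosed (K : Set H))
    (hx : x ∈ K) (h : ∀ i, ∀ v ∈ K, star (π (gen n i)) v ∈ K) : corrSpace π x ≤ K := by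
  refine Submodule.topologicalClosure_minimal _ (Submodule.span_le.2 ?_) hK
  rintro _ ⟨J, rfl⟩
  change star (π (word J)) x ∈ K
  induction J generalizing x with
  | nil => simpa [word] using hx
  | cons i J ih =>
    have : star (π (word (i :: J))) x = star (π (word J)) (star (π (gen n i)) x) := by
      simp [word]
    rw [this]
    exact ih (h i x hx)

theorem star_gen_mem_corrSpace (π : Rep n H) (x : H) (i : Idx n) {v : H}
    (hv : v ∈ corrSpace π x) : star (π (gen n i)) v ∈ corrSpace π x := by
  have hle : corrSpace π x ≤
      (corrSpace π x).comap (star (π (gen n i)) : H →L[ℂ] H).toLinearMap := by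
    refine Submodule.topologicalClosure_minimal _ (Submodule.span_le.2 ?_)
      ((isClosed_corrSpace π x).preimage (star (π (gen n i))).continuous)
    rintro _ ⟨J, rfl⟩
    -- Adjoints reverse products, so the new letter goes at the end of the word.
    have : star (π (gen n i)) (star (π (word J)) x) = star (π (word (J ++ [i]))) x := by
      simp [word]
    change star (π (gen n i)) (star (π (word J)) x) ∈ corrSpace π x
    rw [this]
    exact star_word_mem_corrSpace π x _
  exact hle hv

/-- The correlation space does not grow when the operators `π(s_i)` are replaced by operators in
the strong closure of their span. -/
theorem corrSpace_le_of_mem_closure {π π' : Rep n H}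
    (h : ∀ i w, π' (gen n i) w ∈
      closure (Submodule.span ℂ (Set.range fun j => π (gen n j) w) : Set H)) (x : H) :
    corrSpace π' x ≤ corrSpace π x := by
  have : CompleteSpace (corrSpace π x) := (isClosed_corrSpace π x).completeSpace_coe
  refine corrSpace_le (isClosed_corrSpace π x) (mem_corrSpace_self π x) fun i v hv => ?_
  -- Writing `K = Kᗮᗮ` moves `π'(s_i)` onto `w ∈ Kᗮ`, where linear combinations and limits of the
  -- `π(s_j) w` cause no trouble.
  rw [← Submodule.orthogonal_orthogonal (corrSpace π x), Submodule.mem_orthogonal]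
  intro w hw
  rw [ContinuousLinearMap.star_eq_adjoint, ContinuousLinearMap.adjoint_inner_right]
  refine Submodule.inner_left_of_mem_orthogonal hv ?_
  have hle : Submodule.span ℂ (Set.range fun j => π (gen n j) w) ≤ (corrSpace π x)ᗮ := by
    rw [Submodule.span_le]
    rintro _ ⟨j, rfl⟩
    refine (Submodule.mem_orthogonal _ _).2 fun u hu => ?_
    rw [← ContinuousLinearMap.adjoint_inner_left, ← ContinuousLinearMap.star_eq_adjoint]
    exact Submodule.inner_right_of_mem_orthogonal (star_gen_mem_corrSpace π x j hu) hw
  exact closure_minimal hle (Submodule.isClosed_orthogonal _) (h i w)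

theorem corrSpace_le_comap {π : Rep n H} {π' : Rep n H'} (W : H ≃ₗᵢ[ℂ] H')
    (hW : ∀ a v, W (π a v) = π' a (W v)) (x : H) :
    corrSpace π x ≤ (corrSpace π' (W x)).comap W.toLinearEquiv.toLinearMap := by
  refine corrSpace_le ((isClosed_corrSpace π' (W x)).preimage W.continuous)
    (mem_corrSpace_self π' (W x)) fun i v hv => ?_
  change W (star (π (gen n i)) v) ∈ corrSpace π' (W x)
  rw [← map_star, hW, map_star]
  exact star_gen_mem_corrSpace π' (W x) i hv

theorem intertwine_symm {π : Rep n H} {π' : Rep n H'} {W : H ≃ₗᵢ[ℂ] H'}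
    (hW : ∀ a v, W (π a v) = π' a (W v)) (a : CuntzAlgebra n) (v : H') :
    W.symm (π' a v) = π a (W.symm v) := by
  rw [LinearIsometryEquiv.symm_apply_eq, hW, LinearIsometryEquiv.apply_symm_apply]

theorem UnitarilyEquivalent.symm {π : Rep n H} {π' : Rep n H'}
    (h : UnitarilyEquivalent π π') : UnitarilyEquivalent π' π :=
  let ⟨W, hW⟩ := h
  ⟨W.symm, intertwine_symm hW⟩

theorem UnitarilyEquivalent.trans {H'' : Type*} [NormedAddCommGroup H'']
    [InnerProductSpace ℂ H''] [CompleteSpace H''] {π : Rep n H} {π' : Rep n H'} {π'' : Rep n H''}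
    (h : UnitarilyEquivalent π π') (h' : UnitarilyEquivalent π' π'') :
    UnitarilyEquivalent π π'' :=
  let ⟨W, hW⟩ := h
  let ⟨W', hW'⟩ := h'
  ⟨W.trans W', fun a v => by
    rw [LinearIsometryEquiv.trans_apply, hW, hW', LinearIsometryEquiv.trans_apply]⟩

theorem corrDim_eq_of_intertwine {π : Rep n H} {π' : Rep n H'} (W : H ≃ₗᵢ[ℂ] H')
    (hW : ∀ a v, W (π a v) = π' a (W v)) (x : H) : corrDim π x = corrDim π' (W x) := by
  have hmap : (corrSpace π x).map W.toLinearEquiv.toLinearMap = corrSpace π' (W x) := by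
    refine le_antisymm (Submodule.map_le_iff_le_comap.2 (corrSpace_le_comap W hW x)) fun y hy => ?_
    have := corrSpace_le_comap W.symm (intertwine_symm hW) (W x) hy
    rw [LinearIsometryEquiv.symm_apply_apply] at this
    exact ⟨W.symm y, this, W.apply_symm_apply y⟩
  -- The two spaces may lie in different universes; `Cardinal.toENat` does not see the lifts.
  have e := (W.toLinearEquiv.submoduleMap (corrSpace π x)).lift_rank_eq
  rw [hmap] at e
  have e' := congrArg Cardinal.toENat e
  rwa [Cardinal.toENat_lift, Cardinal.toENat_lift] at e'

theorem one_le_corrDim (π : Rep n H) {x : H} (hx : ‖x‖ = 1) : 1 ≤ corrDim π x := by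
  have hx0 : x ≠ 0 := fun h => by simp [h] at hx
  have hbot : corrSpace π x ≠ ⊥ := fun h =>
    hx0 ((Submodule.mem_bot ℂ).1 (h ▸ mem_corrSpace_self π x))
  rw [corrDim, Order.one_le_iff_ne_zero]
  simpa using hbot

/-- The least dimension of a correlation space of a unit vector. -/
def minCorrDim (π : Rep n H) : ℕ∞ := sInf {d | ∃ y : H, ‖y‖ = 1 ∧ corrDim π y = d}

theorem one_le_minCorrDim (π : Rep n H) : 1 ≤ minCorrDim π := by
  refine le_sInf ?_
  rintro _ ⟨y, hy, rfl⟩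
  exact one_le_corrDim π hy

theorem minCorrDim_le_of_intertwine {π : Rep n H} {π' : Rep n H'} (W : H ≃ₗᵢ[ℂ] H')
    (hW : ∀ a v, W (π a v) = π' a (W v)) : minCorrDim π' ≤ minCorrDim π := by
  refine le_sInf ?_
  rintro _ ⟨y, hy, rfl⟩
  exact sInf_le ⟨W y, by rw [W.norm_map, hy], (corrDim_eq_of_intertwine W hW y).symm⟩

theorem UnitarilyEquivalent.minCorrDim_eq {π : Rep n H} {π' : Rep n H'}
    (h : UnitarilyEquivalent π π') : minCorrDim π = minCorrDim π' :=
  let ⟨W, hW⟩ := h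
  le_antisymm (minCorrDim_le_of_intertwine W.symm (intertwine_symm hW))
    (minCorrDim_le_of_intertwine W hW)

theorem minCorrDim_eq_of_mem_closure {π π' : Rep n H}
    (h : ∀ i w, π' (gen n i) w ∈
      closure (Submodule.span ℂ (Set.range fun j => π (gen n j) w) : Set H))
    (h' : ∀ i w, π (gen n i) w ∈
      closure (Submodule.span ℂ (Set.range fun j => π' (gen n j) w) : Set H)) :
    minCorrDim π = minCorrDim π' := by
  have hx : ∀ x, corrDim π x = corrDim π' x := fun x => by
    rw [corrDim, corrDim, le_antisymm (corrSpace_le_of_mem_closure h' x)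
      (corrSpace_le_of_mem_closure h x)]
  simp_rw [minCorrDim, hx]

end Correlation

/-! ### Uniqueness of the GNS representation -/

section GNS

variable {n : ℕ∞} {H : Type*} [NormedAddCommGroup H] [InnerProductSpace ℂ H] [CompleteSpace H]

theorem gnsRep_coe (ω : State n) (a : CuntzAlgebra n) (b : ω.1.PreGNS) :
    gnsRep ω a (b : ω.1.GNS) = ((ω.1.toPreGNS (a * ω.1.ofPreGNS b) : ω.1.PreGNS) : ω.1.GNS) :=
  PositiveLinearMap.gnsNonUnitalStarAlgHom_apply_coe _

theorem norm_gnsVector (ω : State n) : ‖gnsVector ω‖ = 1 := by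
  rw [gnsVector, UniformSpace.Completion.norm_coe, PositiveLinearMap.preGNS_norm_def]
  simp [ω.2]

theorem vectorState_apply (π : Rep n H) {x : H} (hx : ‖x‖ = 1) (a : CuntzAlgebra n) :
    (vectorState π x hx).1 a = ⟪x, π a x⟫_ℂ := rfl

/-- The isometry `a ↦ π(a) x` from the pre-GNS space of the vector state of `x`. -/
def preGNSIsometry (π : Rep n H) (x : H) (hx : ‖x‖ = 1) :
    (vectorState π x hx).1.PreGNS →ₗᵢ[ℂ] H where
  toFun a := π ((vectorState π x hx).1.ofPreGNS a) x
  map_add' a b := by simp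
  map_smul' c a := by simp
  norm_map' a := by
    change ‖π ((vectorState π x hx).1.ofPreGNS a) x‖ = _
    rw [PositiveLinearMap.preGNS_norm_def, vectorState_apply, map_mul, map_star,
      mul_apply_eq_comp, ContinuousLinearMap.star_eq_adjoint,
      ContinuousLinearMap.adjoint_inner_right, norm_eq_sqrt_re_inner (𝕜 := ℂ)]
    rfl

/-- The isometry from the GNS space of the vector state of `x`. -/
def gnsIsometry (π : Rep n H) (x : H) (hx : ‖x‖ = 1) :
    (vectorState π x hx).1.GNS →ₗᵢ[ℂ] H where
  __ := (preGNSIsometry π x hx).toContinuousLinearMap.fromCompletion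
  norm_map' a := by
    change ‖(preGNSIsometry π x hx).toContinuousLinearMap.fromCompletion a‖ = ‖a‖
    induction a using UniformSpace.Completion.induction_on with
    | hp => exact isClosed_eq (by fun_prop) (by fun_prop)
    | ih a =>
      rw [ContinuousLinearMap.fromCompletion_apply_coe, UniformSpace.Completion.norm_coe]
      exact (preGNSIsometry π x hx).norm_map a

theorem gnsIsometry_coe (π : Rep n H) (x : H) (hx : ‖x‖ = 1)
    (a : (vectorState π x hx).1.PreGNS) :
    gnsIsometry π x hx (a : (vectorState π x hx).1.GNS) =
      π ((vectorState π x hx).1.ofPreGNS a) x :=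
  ContinuousLinearMap.fromCompletion_apply_coe _ _

theorem gnsIsometry_gnsVector (π : Rep n H) (x : H) (hx : ‖x‖ = 1) :
    gnsIsometry π x hx (gnsVector _) = x := by
  rw [gnsVector, gnsIsometry_coe]
  simp

theorem gnsIsometry_gnsRep (π : Rep n H) (x : H) (hx : ‖x‖ = 1) (a : CuntzAlgebra n)
    (v : (vectorState π x hx).1.GNS) :
    gnsIsometry π x hx (gnsRep _ a v) = π a (gnsIsometry π x hx v) := by
  induction v using UniformSpace.Completion.induction_on with
  | hp =>
    exact isClosed_eq ((gnsIsometry π x hx).continuous.comp (gnsRep _ a).continuous)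
      ((π a).continuous.comp (gnsIsometry π x hx).continuous)
  | ih b =>
    rw [gnsRep_coe, gnsIsometry_coe, gnsIsometry_coe]
    simp

/-- The range is closed, being that of an isometry on a complete space, is invariant under `π`, and
contains `x ≠ 0`. -/
theorem gnsIsometry_surjective {π : Rep n H} (hπ : IsIrreducible π) (x : H) (hx : ‖x‖ = 1) :
    Function.Surjective (gnsIsometry π x hx) := by
  have hcl : IsClosed ((gnsIsometry π x hx).toLinearMap.range : Set H) := by
    rw [LinearMap.coe_range]
    exact (gnsIsometry π x hx).isometry.isClosedEmbedding.isClosed_range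
  rcases hπ.2 _ hcl (by
    rintro a _ ⟨v, rfl⟩
    exact ⟨gnsRep _ a v, gnsIsometry_gnsRep π x hx a v⟩) with h | h
  · have hx0 : x ∈ (gnsIsometry π x hx).toLinearMap.range :=
      ⟨gnsVector _, gnsIsometry_gnsVector π x hx⟩
    rw [h, Submodule.mem_bot] at hx0
    simp [hx0] at hx
  · exact LinearMap.range_eq_top.1 h

theorem exists_gnsRep_intertwine {π : Rep n H} (hπ : IsIrreducible π) (x : H) (hx : ‖x‖ = 1) :
    ∃ W : (vectorState π x hx).1.GNS ≃ₗᵢ[ℂ] H,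
      (∀ a v, W (gnsRep _ a v) = π a (W v)) ∧ W (gnsVector _) = x :=
  ⟨LinearIsometryEquiv.ofSurjective (gnsIsometry π x hx) (gnsIsometry_surjective hπ x hx),
    gnsIsometry_gnsRep π x hx, gnsIsometry_gnsVector π x hx⟩

theorem cdim_eq_corrDim (ω : State n) : cdim ω = corrDim (gnsRep ω) (gnsVector ω) := rfl

theorem kappa_vectorState {π : Rep n H} (hπ : IsIrreducible π) (x : H) (hx : ‖x‖ = 1) :
    kappa (vectorState π x hx) = minCorrDim π := by
  have hx' : UnitarilyEquivalent (gnsRep (vectorState π x hx)) π :=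
    let ⟨W, hW, _⟩ := exists_gnsRep_intertwine hπ x hx
    ⟨W, hW⟩
  apply le_antisymm
  · refine le_sInf ?_
    -- Any unit vector `y` is cyclic too, so its vector state competes in the minimum defining `κ`.
    rintro _ ⟨y, hy, rfl⟩
    obtain ⟨W, hW, hWy⟩ := exists_gnsRep_intertwine hπ y hy
    refine sInf_le ⟨vectorState π y hy, UnitarilyEquivalent.trans ⟨W, hW⟩ hx'.symm, ?_⟩
    rw [cdim_eq_corrDim, corrDim_eq_of_intertwine W hW, hWy]
  · refine le_sInf ?_
    -- Conversely, the image of `Ω` in `H` is a unit vector realizing `cdim ω`.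
    rintro _ ⟨ω, hω, rfl⟩
    obtain ⟨W, hW⟩ := UnitarilyEquivalent.trans hω hx'
    refine sInf_le ⟨W (gnsVector ω), by rw [W.norm_map, norm_gnsVector], ?_⟩
    rw [cdim_eq_corrDim, corrDim_eq_of_intertwine W hW]

theorem kappaRep_eq {π : Rep n H} (hπ : IsIrreducible π) : kappaRep π = minCorrDim π := by
  have := hπ.1
  have h : ∃ x : H, ‖x‖ = 1 := exists_norm_eq H zero_le_one
  rw [kappaRep, dif_pos h, kappa_vectorState hπ]

end GNS

theorem mem_closure_span_of_hasSum {ι E : Type*} [NormedAddCommGroup E] [NormedSpace ℂ E]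
    {c : ι → ℂ} {f : ι → E} {y : E} (h : HasSum (fun i => c i • f i) y) :
    y ∈ closure (Submodule.span ℂ (Set.range f) : Set E) :=
  mem_closure_of_tendsto h (Filter.Eventually.of_forall fun _ =>
    Submodule.sum_mem _ fun i _ => Submodule.smul_mem _ _ (Submodule.subset_span ⟨i, rfl⟩))

/-! ### Invariance under the action of `U(n)` -/

section Action

variable {n : ℕ∞} {H : Type*} [NormedAddCommGroup H] [InnerProductSpace ℂ H] [CompleteSpace H]

/-- Since `α_g` is surjective, both representations have the same operators, hence the same
invariant subspaces. -/
theorem IsIrreducible.comp_action {π : Rep n H} (hπ : IsIrreducible π) (g : U n) :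
    IsIrreducible (π.comp (action g)) := by
  refine ⟨hπ.1, fun M hM h => hπ.2 M hM fun a v hv => ?_⟩
  obtain ⟨b, rfl⟩ := action_surjective g a
  exact h b v hv

theorem action_gen_mem_closure (π : Rep n H) (g : U n) (i : Idx n) (w : H) :
    π (action g (gen n i)) w ∈
      closure (Submodule.span ℂ (Set.range fun j => π (gen n j) w) : Set H) := by
  have h1 := ((hasSum_action_gen g i).map π (continuous_starAlgHom π)).map
    (ContinuousLinearMap.apply ℂ H w) (ContinuousLinearMap.continuous _)
  refine mem_closure_span_of_hasSum (c := fun j => entry g j i) ?_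
  convert h1 using 1
  · exact funext fun j => by simp
  · rfl

theorem minCorrDim_comp_action (π : Rep n H) (g : U n) :
    minCorrDim (π.comp (action g)) = minCorrDim π := by
  refine minCorrDim_eq_of_mem_closure (fun i w => ?_) (action_gen_mem_closure π g)
  -- Rotating `π ∘ α_g` back by `g^*` recovers `π`, giving the reverse inclusion of spans.
  have h := action_gen_mem_closure (π.comp (action g)) (star g) i w
  have hg : action g (action (star g) (gen n i)) = gen n i :=
    DFunLike.congr_fun (action_comp_star g) (gen n i)
  rwa [StarAlgHom.comp_apply, hg] at h

end Action

/-! ### Ergodic endomorphisms -/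

section Endomorphisms

variable {n : ℕ∞} {φ : EndB} {π π' : Rep n (Ell2 ℕ)}

theorem Rep.star_gen_mul_gen {H : Type*} [NormedAddCommGroup H] [InnerProductSpace ℂ H]
    [CompleteSpace H] (π : Rep n H) (i j : Idx n) :
    star (π (gen n i)) * π (gen n j) = if i = j then 1 else 0 := by
  rw [← map_star, ← map_mul, (gen_isCuntzFamily n).star_mul]
  split_ifs <;> simp

/-- By `s_i^* s_j = δ_ij`, only the `j`-th term of the series survives. -/
theorem IsImplementedBy.mul_gen (h : IsImplementedBy φ π) (X : Ell2 ℕ →L[ℂ] Ell2 ℕ) (j : Idx n) :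
    φ X * π (gen n j) = π (gen n j) * X := by
  ext1 w
  have h1 := h X (π (gen n j) w)
  have hi : ∀ i, (π (gen n i) * X * star (π (gen n i))) (π (gen n j) w) =
      (π (gen n i) * X * (if i = j then 1 else 0)) w := fun i => by
    rw [← π.star_gen_mul_gen i j, ← mul_apply_eq_comp, mul_assoc _ (star _)]
  simp_rw [hi] at h1
  refine h1.unique ?_
  convert hasSum_single j fun i hij => ?_ using 1
  · simp
  · simp [hij]

theorem IsImplementedBy.star_gen_mul (h : IsImplementedBy φ π) (X : Ell2 ℕ →L[ℂ] Ell2 ℕ)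
    (j : Idx n) : star (π (gen n j)) * φ X = X * star (π (gen n j)) := by
  have := congrArg star (h.mul_gen (star X) j)
  simpa [← map_star] using this

/-- The operators `π(a)` are closed under adjoints, so they preserve `Mᗮ` along with `M`. -/
theorem starProjection_commute {H : Type*} [NormedAddCommGroup H] [InnerProductSpace ℂ H]
    [CompleteSpace H] {π : Rep n H} {M : Submodule ℂ H} [M.HasOrthogonalProjection]
    (hM : ∀ a, ∀ v ∈ M, π a v ∈ M) (a : CuntzAlgebra n) :
    M.starProjection * π a = π a * M.starProjection := by
  ext1 v
  refine Submodule.eq_starProjection_of_mem_orthogonal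
    (hM a _ (Submodule.starProjection_apply_mem M v)) ?_
  change π a v - π a (M.starProjection v) ∈ Mᗮ
  rw [← map_sub, Submodule.mem_orthogonal]
  intro u hu
  rw [← ContinuousLinearMap.adjoint_inner_left, ← ContinuousLinearMap.star_eq_adjoint, ← map_star]
  exact Submodule.inner_right_of_mem_orthogonal (hM _ u hu)
    (Submodule.sub_starProjection_mem_orthogonal v)

theorem IsImplementedBy.isIrreducible (h : IsImplementedBy φ π) (hφ : IsErgodic φ) :
    IsIrreducible π := by
  refine ⟨inferInstance, fun M hcl hM => ?_⟩
  have : CompleteSpace M := hcl.completeSpace_coe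
  -- Commuting `P` past `π(s_i)` gives `φ(P) = P φ(1) = P`.
  have hP : φ M.starProjection = M.starProjection := by
    ext1 v
    refine (h M.starProjection v).unique ?_
    have h1 := (h 1 v).map M.starProjection (ContinuousLinearMap.continuous _)
    rw [map_one, one_apply_eq_self] at h1
    convert h1 using 1
    funext i
    rw [Function.comp_apply, ← mul_apply_eq_comp, mul_one, ← mul_assoc,
      starProjection_commute hM]
  obtain ⟨c, hc⟩ := (Set.ext_iff.1 hφ M.starProjection).1 hP
  rcases eq_or_ne M ⊥ with hbot | hbot
  · exact Or.inl hbot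
  · obtain ⟨v, hv, hv0⟩ := Submodule.exists_mem_ne_zero_of_ne_bot hbot
    -- A nonzero `v ∈ M` is fixed by `P = c • 1`, so `c = 1`.
    have h1 : c • v = (1 : ℂ) • v := by
      rw [one_smul]
      nth_rw 2 [← Submodule.starProjection_eq_self_iff.2 hv]
      rw [← hc]
      rfl
    refine Or.inr (eq_top_iff.2 fun w _ => ?_)
    rw [← Submodule.starProjection_eq_self_iff, ← hc, smul_left_injective ℂ hv0 h1]
    exact one_smul ℂ w

theorem IsImplementedBy.gen_mem_closure (h : IsImplementedBy φ π) (h' : IsImplementedBy φ π')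
    (j : Idx n) (w : Ell2 ℕ) : π' (gen n j) w ∈
      closure (Submodule.span ℂ (Set.range fun i => π (gen n i) w) : Set (Ell2 ℕ)) := by
  have hs : ∀ i, ∃ c : ℂ, c • (1 : Ell2 ℕ →L[ℂ] Ell2 ℕ) = star (π (gen n i)) * π' (gen n j) := by
    intro i
    have hmem : star (π (gen n i)) * π' (gen n j) ∈
        Subalgebra.center ℂ (Ell2 ℕ →L[ℂ] Ell2 ℕ) :=
      Subalgebra.mem_center_iff.2 fun X => by
        -- `X s_i^* s'_j = s_i^* φ(X) s'_j = s_i^* s'_j X`.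
        rw [← mul_assoc, ← h.star_gen_mul, mul_assoc, h'.mul_gen, mul_assoc]
    rw [Algebra.IsCentral.center_eq_bot, Algebra.mem_bot] at hmem
    obtain ⟨c, hc⟩ := hmem
    exact ⟨c, by rw [← hc, Algebra.algebraMap_eq_smul_one]⟩
  choose c hc using hs
  refine mem_closure_span_of_hasSum (c := c) ?_
  -- Unitality of `φ` makes `∑ π(s_i) π(s_i)^* = 1` strongly, which for `n = ∞` does not follow from
  -- the Cuntz relations.
  have h1 := h 1 (π' (gen n j) w)
  rw [map_one, one_apply_eq_self] at h1
  convert h1 using 1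
  funext i
  rw [mul_one, ← mul_apply_eq_comp, mul_assoc, ← hc]
  simp

theorem IsImplementedBy.minCorrDim_eq (h : IsImplementedBy φ π) (h' : IsImplementedBy φ π') :
    minCorrDim π = minCorrDim π' :=
  minCorrDim_eq_of_mem_closure (h.gen_mem_closure h') (h'.gen_mem_closure h)

theorem kappaEnd_eq (h : IsImplementedBy φ π) (hφ : IsErgodic φ) :
    kappaEnd n φ = minCorrDim π := by
  have hp : HasPowersIndex φ n := ⟨π, h⟩
  rw [kappaEnd, dif_pos hp, kappaRep_eq (hp.choose_spec.isIrreducible hφ),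
    hp.choose_spec.minCorrDim_eq h]

theorem IsErgodic.conjugate {φ φ' : EndB} (hφ : IsErgodic φ) (h : Conjugate φ φ') :
    IsErgodic φ' := by
  obtain ⟨γ, hγ⟩ := h
  ext X
  have h1 : φ' X = X ↔ φ (γ.symm X) = γ.symm X := by
    rw [hγ]
    exact γ.toEquiv.eq_symm_apply.symm
  refine h1.trans ((Set.ext_iff.1 hφ (γ.symm X)).trans ?_)
  constructor
  · rintro ⟨c, hc⟩
    refine ⟨c, ?_⟩
    have := congrArg γ hc
    simpa using this
  · rintro ⟨c, rfl⟩
    exact ⟨c, by simp⟩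

theorem IsImplementedBy.conjugate {φ φ' : EndB} (hφ : IsImplementedBy φ π)
    (h : Conjugate φ φ') : ∃ π' : Rep n (Ell2 ℕ), IsImplementedBy φ' π' ∧
      UnitarilyEquivalent π π' := by
  obtain ⟨γ, hγ⟩ := h
  -- Every automorphism of `B(ℋ)` is conjugation by a unitary `W`; then `W π(·) W^*` implements
  -- `φ'`.
  obtain ⟨W, rfl⟩ := StarAlgEquiv.eq_linearIsometryEquivConjStarAlgEquiv γ
    (AddMonoidHomClass.continuous_of_bound γ 1
      fun x => by rw [one_mul]; exact NonUnitalStarAlgHom.norm_apply_le γ x)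
  refine ⟨(W.conjStarAlgEquiv : _ →⋆ₐ[ℂ] _).comp π, fun X v => ?_, W, fun a v => ?_⟩
  · have h1 := (hφ (W.conjStarAlgEquiv.symm X) (W.symm v)).map W W.continuous
    rw [hγ]
    refine Eq.subst (motive := fun f => HasSum f _) (funext fun i => ?_) h1
    have hi : W.conjStarAlgEquiv (π (gen n i) * W.conjStarAlgEquiv.symm X * star (π (gen n i))) =
        W.conjStarAlgEquiv (π (gen n i)) * X * star (W.conjStarAlgEquiv (π (gen n i))) := by
      rw [map_mul, map_mul, map_star, StarAlgEquiv.apply_symm_apply]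
    exact congrArg (fun T : Ell2 ℕ →L[ℂ] Ell2 ℕ => T v) hi
  · change _ = W (π a (W.symm (W v)))
    rw [W.symm_apply_apply]

end Endomorphisms

end

end Cuntz

theorem proposition4p1 (n : ℕ∞) (hn : 2 ≤ n) :
    -- `κ(π)` is well defined, with values in `{1, 2, …, ∞}`
    (∀ (H : Type u) [NormedAddCommGroup H] [InnerProductSpace ℂ H] [CompleteSpace H]
      (π : Cuntz.Rep n H), Cuntz.IsIrreducible π →
        (∀ (x : H) (hx : ‖x‖ = 1), Cuntz.kappa (Cuntz.vectorState π x hx) = Cuntz.kappaRep π) ∧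
        1 ≤ Cuntz.kappaRep π) ∧
    -- invariance under unitary equivalence
    (∀ (H : Type u) [NormedAddCommGroup H] [InnerProductSpace ℂ H] [CompleteSpace H]
      (H' : Type v) [NormedAddCommGroup H'] [InnerProductSpace ℂ H'] [CompleteSpace H']
      (π : Cuntz.Rep n H) (π' : Cuntz.Rep n H'),
        Cuntz.IsIrreducible π → Cuntz.IsIrreducible π' → Cuntz.UnitarilyEquivalent π π' →
        Cuntz.kappaRep π = Cuntz.kappaRep π') ∧
    -- invariance under the action of `U(n)`
    (∀ (H : Type u) [NormedAddCommGroup H] [InnerProductSpace ℂ H] [CompleteSpace H]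
      (π : Cuntz.Rep n H) (g : Cuntz.U n), Cuntz.IsIrreducible π →
        Cuntz.IsIrreducible (π.comp (Cuntz.action g)) ∧
        Cuntz.kappaRep (π.comp (Cuntz.action g)) = Cuntz.kappaRep π) ∧
    -- `κ` is a well-defined conjugacy invariant on `Erg_n B(ℋ)`, with values in `{1, 2, …, ∞}`
    (∀ φ ∈ Cuntz.Erg n,
      (∀ π : Cuntz.Rep n (Cuntz.Ell2 ℕ), Cuntz.IsImplementedBy φ π →
        Cuntz.IsIrreducible π ∧ Cuntz.kappaEnd n φ = Cuntz.kappaRep π) ∧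
      1 ≤ Cuntz.kappaEnd n φ ∧
      ∀ φ' : Cuntz.EndB, Cuntz.Conjugate φ φ' →
        φ' ∈ Cuntz.Erg n ∧ Cuntz.kappaEnd n φ' = Cuntz.kappaEnd n φ) := by
  refine ⟨fun H _ _ _ π hπ => ⟨fun x hx => ?_, ?_⟩, fun H _ _ _ H' _ _ _ π π' hπ hπ' h => ?_,
    fun H _ _ _ π g hπ => ⟨hπ.comp_action g, ?_⟩, fun φ hφ => ?_⟩
  · rw [Cuntz.kappa_vectorState hπ, Cuntz.kappaRep_eq hπ]
  · rw [Cuntz.kappaRep_eq hπ]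
    exact Cuntz.one_le_minCorrDim π
  · rw [Cuntz.kappaRep_eq hπ, Cuntz.kappaRep_eq hπ', h.minCorrDim_eq]
  · rw [Cuntz.kappaRep_eq hπ, Cuntz.kappaRep_eq (hπ.comp_action g), Cuntz.minCorrDim_comp_action]
  · obtain ⟨⟨π, hπ⟩, he⟩ := hφ
    refine ⟨fun π' hπ' => ⟨hπ'.isIrreducible he, ?_⟩, ?_, fun φ' hφ' => ?_⟩
    · rw [Cuntz.kappaEnd_eq hπ' he, Cuntz.kappaRep_eq (hπ'.isIrreducible he)]
    · rw [Cuntz.kappaEnd_eq hπ he]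
      exact Cuntz.one_le_minCorrDim π
    · obtain ⟨π', hπ', h⟩ := hπ.conjugate hφ'
      refine ⟨⟨⟨π', hπ'⟩, he.conjugate hφ'⟩, ?_⟩
      rw [Cuntz.kappaEnd_eq hπ' (he.conjugate hφ'), Cuntz.kappaEnd_eq hπ he, h.minCorrDim_eq]
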